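/- Let $C$ (customer types) and $S$ (server types) be non-empty finite sets and let $E\subset C\times S$ be such that the bipartite graph $(C,S,E)$ is connected. For $c\in C$, $s\in S$ put $S(c)=\{t:(c,t)\in E\}$ and $C(s)=\{d:(d,s)\in E\}$; for $U\subset C$, $V\subset S$ put $S(U)=\bigcup_{c\in U}S(c)$ and $C(V)=\bigcup_{s\in V}C(s)$. The states of the buffer are the elements of $$\mathcal E=\Bigl\{(x,y)\in\mathbb N^C\times\mathbb N^S:\ \sum_{c}x_c=\sum_{s}y_s,\ \ x_cy_s=0\ \text{for all }(c,s)\in E\Bigr\}.$$ At each time step a pair $(c,s)$ arrives; the arrivals are i.i.d. with law $\mu$, a probability measure on $C\times S$ whose marginals $\mu_C$ and $\mu_S$ have full support $C$ and $S$. Under the Match-the-Longest policy (ML), if $x_i>0$ for some $i\in C(s)$, then the server $s$ leaves together with a customer whose type $\Phi$ is uniformly distributed on $\arg\max\{x_i:i\in C(s)\}$; likewise, if $y_j>0$ for some $j\in S(c)$, then the customer $c$ leaves together with a server whose type $\Psi$ is uniformly distributed on $\arg\max\{y_j:j\in S(c)\}$ (the two choices being independent of each other, given the state and the arrival, and of the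 past). If exactly one of $c$, $s$ is matched in this way, the other one is added to the buffer. If neither is, then $c$ and $s$ leave together when $(c,s)\in E$, and both are added to the buffer when $(c,s)\notin E$. Let $P_\mu$ be the transition matrix of the resulting Markov chain on $\mathcal E$. The model is called *stable* if this chain has a unique stationary probability measure $\pi$ and $\pi$ is attractive, that is, for every probability measure $\nu$ on $\mathcal E$ the Cesàro averages of $(\nu P_\mu^n)_{n\ge 0}$ converge weakly to $\pi$. **Theorem.** For every connected bipartite graph $(C,S,E)$ the ML policy has a maximal stability region: for every probability measure $\mu$ on $C\times S$ whose marginals have full support, the model is stable if and only if $$\mu_C(U)<\mu_S(S(U))\quad\text{for all }\emptyset\neq U\subsetneq C,\qquad \mu_S(V)<\mu_C(C(V))\quad\text{for all }\emptyset\neq V\subsetneq S.$$ -/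

import Mathlib

open scoped Topology

noncomputable section

namespace BipartiteMatching

/-! ### Markov chains with a transition matrix given by its rows, as probability mass functions -/

/-- `π P = π`. -/
def IsStationary {X : Type*} (P : X → PMF X) (π : PMF X) : Prop :=
  π.bind P = π

/-- The law `ν Pⁿ` of the chain at time `n`, for the initial law `ν`. -/
def lawAt {X : Type*} (P : X → PMF X) (ν : PMF X) (n : ℕ) : PMF X :=
  (fun ρ => ρ.bind P)^[n] ν

/-- The Cesàro average `(ν + ν P + ⋯ + ν Pⁿ) / (n + 1)`, written as the uniform mixture of the laws
at the times `0, …, n`. -/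
def cesaro {X : Type*} (P : X → PMF X) (ν : PMF X) (n : ℕ) : PMF X :=
  (PMF.uniformOfFintype (Fin (n + 1))).bind fun k => lawAt P ν k

/-- A probability mass function as a probability measure. -/
def toProbabilityMeasure {X : Type*} [MeasurableSpace X] (ρ : PMF X) :
    MeasureTheory.ProbabilityMeasure X :=
  ⟨ρ.toMeasure, PMF.toMeasure.isProbabilityMeasure ρ⟩

/-- `π` is attractive: for every initial law `ν`, the Cesàro averages of `ν Pⁿ` converge weakly
to `π`. -/
def IsAttractive {X : Type*} [TopologicalSpace X] [MeasurableSpace X] [OpensMeasurableSpace X]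
    (P : X → PMF X) (π : PMF X) : Prop :=
  ∀ ν : PMF X, Filter.Tendsto (fun n => toProbabilityMeasure (cesaro P ν n)) Filter.atTop
    (𝓝 (toProbabilityMeasure π))

/-- The chain has a unique stationary probability measure, and this measure is attractive. -/
def IsStable {X : Type*} [TopologicalSpace X] [MeasurableSpace X] [OpensMeasurableSpace X]
    (P : X → PMF X) : Prop :=
  ∃ π : PMF X, IsStationary P π ∧ (∀ π', IsStationary P π' → π' = π) ∧ IsAttractive P π

/-! ### The matching graph and the state space -/

section Model

variable {C S : Type*}

/-- The bipartite graph `(C, S, E)`, as an undirected graph on the disjoint union of `C` and `S`. -/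
def matchingGraph (E : Set (C × S)) : SimpleGraph (C ⊕ S) :=
  SimpleGraph.fromRel fun a b => ∃ c s, (c, s) ∈ E ∧ a = Sum.inl c ∧ b = Sum.inr s

variable [Fintype C] [Fintype S]

/-- The commutative state space: `x c` customers of type `c` and `y s` servers of type `s`, as many
customers as servers, and no two of them that can be matched. Its topology and its σ-algebra are
those induced from the product of copies of `ℕ`, hence discrete. -/
abbrev State (E : Set (C × S)) : Type _ :=
  {z : (C → ℕ) × (S → ℕ) // ∑ c, z.1 c = ∑ s, z.2 s ∧ ∀ c s, (c, s) ∈ E → z.1 c * z.2 s = 0}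

/-- The customer types that are present in `x` and can be matched with an `s`-server. -/
abbrev AvailableCustomers (E : Set (C × S)) (x : C → ℕ) (s : S) : Type _ :=
  {c : C // (c, s) ∈ E ∧ 0 < x c}

/-- The server types that are present in `y` and can be matched with a `c`-customer. -/
abbrev AvailableServers (E : Set (C × S)) (y : S → ℕ) (c : C) : Type _ :=
  {s : S // (c, s) ∈ E ∧ 0 < y s}

/-- An admissible (possibly randomized) matching policy on the commutative state space, given by the
laws of the random choices `Φ(x, s)` and `Ψ(y, c)`, made when there is something to choose. -/
structure Policy (E : Set (C × S)) where
  Φ : ∀ (x : C → ℕ) (s : S), Nonempty (AvailableCustomers E x s) → PMF (AvailableCustomers E x s)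
  Ψ : ∀ (y : S → ℕ) (c : C), Nonempty (AvailableServers E y c) → PMF (AvailableServers E y c)

open Classical in
/-- One more individual of type `a`. -/
def addOne {A : Type*} (x : A → ℕ) (a : A) : A → ℕ := x + Pi.single a 1

open Classical in
/-- One individual of type `a` less; only used when `0 < x a`. -/
def removeOne {A : Type*} (x : A → ℕ) (a : A) : A → ℕ := x - Pi.single a 1

theorem sum_addOne {A : Type*} [Fintype A] (x : A → ℕ) (a : A) :
    ∑ i, addOne x a i = ∑ i, x i + 1 := by
  classical
  simp [addOne, Finset.sum_add_distrib, Pi.single_apply]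

theorem addOne_removeOne {A : Type*} (x : A → ℕ) (a : A) (h : 0 < x a) :
    addOne (removeOne x a) a = x := by
  classical
  funext i
  by_cases hi : i = a
  · subst hi
    simp [addOne, removeOne]
    omega
  · simp [addOne, removeOne, hi]

theorem sum_removeOne {A : Type*} [Fintype A] (x : A → ℕ) (a : A) (h : 0 < x a) :
    ∑ i, removeOne x a i + 1 = ∑ i, x i := by
  rw [← sum_addOne (removeOne x a) a, addOne_removeOne x a h]

theorem removeOne_le {A : Type*} (x : A → ℕ) (a i : A) : removeOne x a i ≤ x i := by
  simp [removeOne]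

theorem addOne_of_ne {A : Type*} (x : A → ℕ) {a i : A} (h : i ≠ a) : addOne x a i = x i := by
  classical
  simp [addOne, h]

/-- Neither the new customer nor the new server finds a match, and they do not match each other. -/
def State.add {E : Set (C × S)} (z : State E) (c : C) (s : S) (hE : (c, s) ∉ E)
    (hs : ¬ Nonempty (AvailableCustomers E z.1.1 s))
    (hc : ¬ Nonempty (AvailableServers E z.1.2 c)) : State E :=
  ⟨(addOne z.1.1 c, addOne z.1.2 s), by
    refine ⟨by simp only [sum_addOne, z.2.1], fun d t hdt => ?_⟩
    simp only [nonempty_subtype, not_exists, not_and, not_lt, Nat.le_zero] at hs hc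
    have h0 := z.2.2 d t hdt
    by_cases hd : d = c
    · subst hd
      have ht : t ≠ s := fun h => hE (h ▸ hdt)
      simp [addOne_of_ne _ ht, hc t hdt]
    · by_cases ht : t = s
      · subst ht
        simp [addOne_of_ne _ hd, hs d hdt]
      · simpa [addOne_of_ne _ hd, addOne_of_ne _ ht] using h0⟩

/-- The new server leaves with a customer `i` and the new customer with a server `j`. -/
def State.removeBoth {E : Set (C × S)} (z : State E) {c : C} {s : S}
    (i : AvailableCustomers E z.1.1 s) (j : AvailableServers E z.1.2 c) : State E :=
  ⟨(removeOne z.1.1 i, removeOne z.1.2 j), by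
    refine ⟨?_, fun d t hdt => ?_⟩
    · have h1 := sum_removeOne z.1.1 i i.2.2
      have h2 := sum_removeOne z.1.2 j j.2.2
      have h3 := z.2.1
      simp only
      omega
    · exact Nat.le_zero.1 ((Nat.mul_le_mul (removeOne_le _ _ _) (removeOne_le _ _ _)).trans
        (z.2.2 d t hdt).le)⟩

/-- The new server leaves with a customer `i`, and the new customer `c` is put into the buffer. -/
def State.replaceCustomer {E : Set (C × S)} (z : State E) {s : S}
    (i : AvailableCustomers E z.1.1 s) (c : C)
    (hc : ¬ Nonempty (AvailableServers E z.1.2 c)) : State E :=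
  ⟨(addOne (removeOne z.1.1 i) c, z.1.2), by
    refine ⟨?_, fun d t hdt => ?_⟩
    · simp only [sum_addOne, sum_removeOne z.1.1 i i.2.2, z.2.1]
    · simp only [nonempty_subtype, not_exists, not_and, not_lt, Nat.le_zero] at hc
      by_cases hd : d = c
      · subst hd
        simp [hc t hdt]
      · simp only [addOne_of_ne _ hd]
        exact Nat.le_zero.1 ((Nat.mul_le_mul_right _ (removeOne_le _ _ _)).trans
          (z.2.2 d t hdt).le)⟩

/-- The new customer leaves with a server `j`, and the new server `s` is put into the buffer. -/
def State.replaceServer {E : Set (C × S)} (z : State E) {c : C}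
    (j : AvailableServers E z.1.2 c) (s : S)
    (hs : ¬ Nonempty (AvailableCustomers E z.1.1 s)) : State E :=
  ⟨(z.1.1, addOne (removeOne z.1.2 j) s), by
    refine ⟨?_, fun d t hdt => ?_⟩
    · simp only [sum_addOne, sum_removeOne z.1.2 j j.2.2, z.2.1]
    · simp only [nonempty_subtype, not_exists, not_and, not_lt, Nat.le_zero] at hs
      by_cases ht : t = s
      · subst ht
        simp [hs d hdt]
      · simp only [addOne_of_ne _ ht]
        exact Nat.le_zero.1 ((Nat.mul_le_mul_left _ (removeOne_le _ _ _)).trans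
          (z.2.2 d t hdt).le)⟩

/-! ### The dynamics -/

open Classical in
/-- The law of the new state `(x, y) ⊙ (c, s)`. Individuals already in the buffer have priority, and
the two choices are independent. -/
def Policy.step {E : Set (C × S)} (pol : Policy E) (z : State E) (a : C × S) : PMF (State E) :=
  if hs : Nonempty (AvailableCustomers E z.1.1 a.2) then
    if hc : Nonempty (AvailableServers E z.1.2 a.1) then
      (pol.Φ z.1.1 a.2 hs).bind fun i => (pol.Ψ z.1.2 a.1 hc).map fun j => z.removeBoth i j
    else
      (pol.Φ z.1.1 a.2 hs).map fun i => z.replaceCustomer i a.1 hc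
  else
    if hc : Nonempty (AvailableServers E z.1.2 a.1) then
      (pol.Ψ z.1.2 a.1 hc).map fun j => z.replaceServer j a.2 hs
    else
      if hE : (a.1, a.2) ∈ E then PMF.pure z
      else PMF.pure (z.add a.1 a.2 hE hs hc)

/-- The transition matrix of the buffer content, when the successive arrivals are independent with
law `μ`. -/
def Policy.chain {E : Set (C × S)} (pol : Policy E) (μ : PMF (C × S)) (z : State E) :
    PMF (State E) :=
  μ.bind fun a => pol.step z a

/-! ### Match the Longest -/

open Classical in
/-- The maximizers of `x` over the customer types that can be matched with an `s`-server. -/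
def longestCustomers (E : Set (C × S)) (x : C → ℕ) (s : S) : Finset (AvailableCustomers E x s) :=
  {i | ∀ d, (d, s) ∈ E → x d ≤ x i}

open Classical in
/-- The maximizers of `y` over the server types that can be matched with a `c`-customer. -/
def longestServers (E : Set (C × S)) (y : S → ℕ) (c : C) : Finset (AvailableServers E y c) :=
  {j | ∀ t, (c, t) ∈ E → y t ≤ y j}

theorem longestCustomers_nonempty (E : Set (C × S)) (x : C → ℕ) (s : S)
    (h : Nonempty (AvailableCustomers E x s)) : (longestCustomers E x s).Nonempty := by
  classical
  obtain ⟨i, hi⟩ := Finite.exists_max fun i : AvailableCustomers E x s => x i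
  refine ⟨i, ?_⟩
  simp only [longestCustomers, Finset.mem_filter, Finset.mem_univ, true_and]
  intro d hd
  by_cases h0 : 0 < x d
  · exact hi ⟨d, hd, h0⟩
  · omega

theorem longestServers_nonempty (E : Set (C × S)) (y : S → ℕ) (c : C)
    (h : Nonempty (AvailableServers E y c)) : (longestServers E y c).Nonempty := by
  classical
  obtain ⟨j, hj⟩ := Finite.exists_max fun j : AvailableServers E y c => y j
  refine ⟨j, ?_⟩
  simp only [longestServers, Finset.mem_filter, Finset.mem_univ, true_and]
  intro t ht
  by_cases h0 : 0 < y t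
  · exact hj ⟨t, ht, h0⟩
  · omega

/-- The policy ML: the choices are uniform among the types with the longest queue. -/
def matchTheLongest (E : Set (C × S)) : Policy E where
  Φ x s h := PMF.uniformOfFinset (longestCustomers E x s) (longestCustomers_nonempty E x s h)
  Ψ y c h := PMF.uniformOfFinset (longestServers E y c) (longestServers_nonempty E y c h)

/-! ### Stability regions -/

open Classical in
/-- `S(U)`, the set of server types that can be matched with some customer type of `U`. -/
def serversOf (E : Set (C × S)) (U : Finset C) : Finset S :=
  {s | ∃ c ∈ U, (c, s) ∈ E}

open Classical in
/-- `C(V)`, the set of customer types that can be matched with some server type of `V`. -/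
def customersOf (E : Set (C × S)) (V : Finset S) : Finset C :=
  {c | ∃ s ∈ V, (c, s) ∈ E}

/-- The conditions NCond on a law `p` on `C` and a law `q` on `S`, over the non-empty proper
subsets. -/
def NCond (E : Set (C × S)) (p : PMF C) (q : PMF S) : Prop :=
  (∀ U : Finset C, U.Nonempty → U ≠ Finset.univ → ∑ c ∈ U, p c < ∑ s ∈ serversOf E U, q s) ∧
  (∀ V : Finset S, V.Nonempty → V ≠ Finset.univ → ∑ s ∈ V, q s < ∑ c ∈ customersOf E V, p c)

/-- Each type of customer and each type of server arrives with positive probability. -/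
def HasFullMarginals (μ : PMF (C × S)) : Prop :=
  (μ.map Prod.fst).support = Set.univ ∧ (μ.map Prod.snd).support = Set.univ

/-- The arrival laws for which the model is stable. -/
def Policy.stabilityRegion {E : Set (C × S)} (pol : Policy E) : Set (PMF (C × S)) :=
  {μ | HasFullMarginals μ ∧ IsStable (pol.chain μ)}

/-- The arrival laws whose marginals satisfy NCond. -/
def ncondRegion (E : Set (C × S)) : Set (PMF (C × S)) :=
  {μ | HasFullMarginals μ ∧ NCond E (μ.map Prod.fst) (μ.map Prod.snd)}

/-- The stability region is all of the region defined by NCond. -/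
def Policy.HasMaximalStabilityRegion {E : Set (C × S)} (pol : Policy E) : Prop :=
  pol.stabilityRegion = ncondRegion E

end Model

end BipartiteMatching

end

/-!
For sufficiency, take the sum of the squares of the queue lengths as a Lyapunov function. An
arrival `(c, s)` raises it by about `2 (x c + y s)`, and the departures under ML lower it by twice
the length of the longest queue that `s` can serve plus twice that of the longest queue that `c`
can serve. The super-level sets `{x > k}` are proper subsets of `C`, and the types whose longest
queue exceeds `k` are exactly their neighbours; so summing NCond over `k` shows that, in the mean,
the longest queues win by a multiple of the buffer size. This negative drift keeps the Cesàro
averages tight, hence stationary laws exist. The empty buffer can be reached from every state, so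
there is only one stationary law, and tightness makes all Cesàro averages converge to it.

For necessity, suppose that `μ_C(U) ≥ μ_S(S(U))`. The number of customers with type in `U` minus
the number of servers with type in `S(U)` is then a submartingale, whatever the policy. Under a
stationary law a submartingale with integrable increments cannot gain along any transition of
positive probability, so the arrivals in the support of `μ` are exactly balanced and the
difference never decreases. It can start from arbitrarily large values, which contradicts
attractiveness.
-/

open Filter MeasureTheory
open scoped ENNReal NNReal

noncomputable section

namespace BipartiteMatching

/-! ### Expectations of non-negative functions -/

section Expectation

variable {X Y : Type*}

/-- The expectation of a `[0, ∞]`-valued function under a discrete law. -/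
def expect (p : PMF X) (f : X → ℝ≥0∞) : ℝ≥0∞ := ∑' z, p z * f z

theorem expect_pure (z : X) (f : X → ℝ≥0∞) : expect (PMF.pure z) f = f z := by
  classical
  rw [expect, tsum_eq_single z fun w hw => by simp [PMF.pure_apply, hw]]
  simp

theorem expect_bind (p : PMF X) (q : X → PMF Y) (f : Y → ℝ≥0∞) :
    expect (p.bind q) f = expect p fun z => expect (q z) f := by
  simp only [expect, PMF.bind_apply, ← ENNReal.tsum_mul_right, ← ENNReal.tsum_mul_left, mul_assoc]
  exact ENNReal.tsum_comm

theorem expect_map (p : PMF X) (g : X → Y) (f : Y → ℝ≥0∞) :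
    expect (p.map g) f = expect p fun z => f (g z) := by
  rw [← PMF.bind_pure_comp, expect_bind]
  simp [expect_pure]

theorem expect_mono {p : PMF X} {f g : X → ℝ≥0∞} (h : ∀ z, p z ≠ 0 → f z ≤ g z) :
    expect p f ≤ expect p g := by
  refine ENNReal.tsum_le_tsum fun z => ?_
  by_cases hz : p z = 0
  · simp [hz]
  · exact mul_le_mul_right (h z hz) _

theorem expect_const (p : PMF X) (c : ℝ≥0∞) : expect p (fun _ => c) = c := by
  rw [expect, ENNReal.tsum_mul_right, p.tsum_coe, one_mul]

theorem expect_add (p : PMF X) (f g : X → ℝ≥0∞) :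
    expect p (fun z => f z + g z) = expect p f + expect p g := by
  simp only [expect, mul_add, ENNReal.tsum_add]

theorem expect_const_mul (p : PMF X) (c : ℝ≥0∞) (f : X → ℝ≥0∞) :
    expect p (fun z => c * f z) = c * expect p f := by
  simp only [expect, mul_left_comm _ c, ENNReal.tsum_mul_left]

theorem expect_eq_sum [Fintype X] (p : PMF X) (f : X → ℝ≥0∞) :
    expect p f = ∑ z, p z * f z :=
  tsum_fintype _

theorem expect_ne_top [Finite X] (p : PMF X) {f : X → ℝ≥0∞} (hf : ∀ z, f z ≠ ∞) :
    expect p f ≠ ∞ := by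
  have := Fintype.ofFinite X
  rw [expect_eq_sum]
  exact ENNReal.sum_ne_top.2 fun z _ => ENNReal.mul_ne_top (p.apply_ne_top z) (hf z)

theorem expect_indicator_one (p : PMF X) (K : Finset X) :
    expect p (fun z => ((K : Set X).indicator (1 : X → ℝ≥0) z : ℝ≥0)) = ∑ z ∈ K, p z := by
  rw [expect, tsum_eq_sum (s := K) fun z hz => by simp [hz]]
  exact Finset.sum_congr rfl fun z hz => by simp [hz]

theorem sum_map_apply (p : PMF X) (g : X → Y) (K : Finset Y) :
    ∑ y ∈ K, p.map g y = expect p fun z => ((K : Set Y).indicator (1 : Y → ℝ≥0) (g z) : ℝ≥0) := by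
  rw [← expect_indicator_one, expect_map]

theorem expect_eq_zero_iff {p : PMF X} {f : X → ℝ≥0∞} :
    expect p f = 0 ↔ ∀ z, p z ≠ 0 → f z = 0 := by
  simp [expect, or_iff_not_imp_left]

theorem eq_of_le_of_tsum_le {f g : X → ℝ≥0∞} (hfg : f ≤ g) (hf : ∑' z, f z ≠ ∞)
    (hsum : ∑' z, g z ≤ ∑' z, f z) : f = g :=
  funext fun z => (hfg z).antisymm <| not_lt.1 fun hlt =>
    (ENNReal.tsum_lt_tsum hf hfg hlt).not_ge hsum

theorem eq_of_forall_apply_le {p q : PMF X} (h : ∀ z, p z ≤ q z) : p = q :=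
  PMF.ext <| congrFun <| eq_of_le_of_tsum_le h p.tsum_coe_ne_top (by simp)

theorem eq_of_le_of_expect_le {p : PMF X} {f g : X → ℝ≥0∞} (hfg : ∀ z, f z ≤ g z)
    (hf : expect p f ≠ ∞) (hgf : expect p g ≤ expect p f) {z : X} (hz : p z ≠ 0) : f z = g z := by
  have h := congrFun (eq_of_le_of_tsum_le (fun z => mul_le_mul_right (hfg z) (p z)) hf hgf) z
  exact (ENNReal.mul_right_inj hz (p.apply_ne_top z)).1 h

theorem tsum_liminf_le (f : ℕ → X → ℝ≥0∞) :
    ∑' z, liminf (fun n => f n z) atTop ≤ liminf (fun n => ∑' z, f n z) atTop := by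
  let _ : MeasurableSpace X := ⊤
  simpa only [lintegral_count] using
    lintegral_liminf_le (μ := Measure.count) fun n => measurable_from_top (f := f n)

end Expectation

/-! ### Uniqueness of the stationary law -/

section Uniqueness

variable {X : Type*} {P : X → PMF X}

/-- The measure `m P`, where the measure `m` is given by its values on the points. -/
def evolve (P : X → PMF X) (m : X → ℝ≥0∞) (w : X) : ℝ≥0∞ := ∑' z, m z * P z w

/-- The relation of being linked by a transition of positive probability. -/
def Linked (P : X → PMF X) (z w : X) : Prop := P z w ≠ 0

theorem evolve_mono {m r : X → ℝ≥0∞} (h : m ≤ r) : evolve P m ≤ evolve P r := fun _ =>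
  ENNReal.tsum_le_tsum fun z => mul_le_mul_left (h z) _

theorem tsum_evolve (m : X → ℝ≥0∞) : ∑' w, evolve P m w = ∑' z, m z := by
  simp only [evolve]
  rw [ENNReal.tsum_comm]
  simp [ENNReal.tsum_mul_left]

theorem IsStationary.evolve_eq {p : PMF X} (hp : IsStationary P p) : evolve P p = p :=
  funext fun w => by
    conv_rhs => rw [← hp, PMF.bind_apply]
    rfl

theorem evolve_eq_of_evolve_le {m : X → ℝ≥0∞} (hm : ∑' z, m z ≠ ∞) (h : evolve P m ≤ m) :
    evolve P m = m :=
  eq_of_le_of_tsum_le h (by rwa [tsum_evolve]) (tsum_evolve m).ge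

theorem evolve_tsub {m r : X → ℝ≥0∞} (hm : ∑' z, m z ≠ ∞) (hmr : m ≤ r)
    (hmP : evolve P m = m) (hrP : evolve P r = r) : evolve P (r - m) = r - m := by
  funext w
  refine ENNReal.eq_sub_of_add_eq (ENNReal.ne_top_of_tsum_ne_top hm w) ?_
  calc evolve P (r - m) w + m w
      = evolve P (r - m) w + evolve P m w := by rw [hmP]
    _ = evolve P (r - m + m) w := by simp only [evolve, Pi.add_apply, add_mul, ENNReal.tsum_add]
    _ = r w := by rw [tsub_add_cancel_of_le hmr, hrP]

theorem ne_zero_of_reachable {m : X → ℝ≥0∞} (hm : evolve P m = m) {z w : X}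
    (h : Relation.ReflTransGen (Linked P) z w) (hz : m z ≠ 0) : m w ≠ 0 := by
  induction h with
  | refl => exact hz
  | tail _ hlink ih =>
    rw [← hm]
    exact fun h0 => mul_ne_zero ih hlink (ENNReal.tsum_eq_zero.1 h0 _)

theorem IsStationary.apply_lt_of_ne {z₀ : X}
    (hz₀ : ∀ z, Relation.ReflTransGen (Linked P) z z₀) {p q : PMF X}
    (hp : IsStationary P p) (hq : IsStationary P q) (hne : p ≠ q) : q z₀ < p z₀ := by
  set m : X → ℝ≥0∞ := ⇑p ⊓ ⇑q
  have hmp : m ≤ p := inf_le_left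
  have hmq : m ≤ q := inf_le_right
  have hm : ∑' z, m z ≠ ∞ := ne_top_of_le_ne_top p.tsum_coe_ne_top (ENNReal.tsum_le_tsum hmp)
  have hmP : evolve P m = m := evolve_eq_of_evolve_le hm <| le_inf
    ((evolve_mono hmp).trans hp.evolve_eq.le) ((evolve_mono hmq).trans hq.evolve_eq.le)
  obtain ⟨z, hz⟩ : ∃ z, (⇑p - m) z ≠ 0 := by
    by_contra! h
    exact hne (eq_of_forall_apply_le fun z => (tsub_eq_zero_iff_le.1 (h z)).trans (hmq z))
  have hpos : p z₀ - min (p z₀) (q z₀) ≠ 0 :=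
    ne_zero_of_reachable (evolve_tsub hm hmp hmP hp.evolve_eq) (hz₀ z) hz
  by_contra! hle
  simp [hle] at hpos

theorem stationary_unique {z₀ : X} (hz₀ : ∀ z, Relation.ReflTransGen (Linked P) z z₀)
    {p q : PMF X} (hp : IsStationary P p) (hq : IsStationary P q) : p = q := by
  by_contra hne
  exact lt_asymm (hp.apply_lt_of_ne hz₀ hq hne) (hq.apply_lt_of_ne hz₀ hp (Ne.symm hne))

end Uniqueness

/-! ### Cesàro averages and tightness -/

section Cesaro

variable {X : Type*} {P : X → PMF X}

theorem lawAt_succ (P : X → PMF X) (ν : PMF X) (n : ℕ) :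
    lawAt P ν (n + 1) = (lawAt P ν n).bind P :=
  Function.iterate_succ_apply' _ _ _

theorem lawAt_eq_bind (P : X → PMF X) (ν : PMF X) (n : ℕ) :
    lawAt P ν n = ν.bind fun z => lawAt P (PMF.pure z) n := by
  induction n with
  | zero => simp [lawAt]
  | succ n ih =>
    simp only [lawAt_succ]
    rw [ih, PMF.bind_bind]

theorem cesaro_eq_bind (P : X → PMF X) (ν : PMF X) (n : ℕ) :
    cesaro P ν n = ν.bind fun z => cesaro P (PMF.pure z) n := by
  simp only [cesaro]
  rw [PMF.bind_comm]
  congr 1 with k : 1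
  exact lawAt_eq_bind P ν k

theorem expect_cesaro (P : X → PMF X) (ν : PMF X) (n : ℕ) (f : X → ℝ≥0∞) :
    expect (cesaro P ν n) f =
      (n + 1 : ℝ≥0∞)⁻¹ * ∑ k ∈ Finset.range (n + 1), expect (lawAt P ν k) f := by
  rw [cesaro, expect_bind, expect_eq_sum, Finset.sum_range, Finset.mul_sum]
  simp

theorem cesaro_apply (P : X → PMF X) (ν : PMF X) (n : ℕ) (w : X) :
    cesaro P ν n w = (n + 1 : ℝ≥0∞)⁻¹ * ∑ k ∈ Finset.range (n + 1), lawAt P ν k w := by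
  rw [cesaro, PMF.bind_apply, tsum_fintype, Finset.sum_range, Finset.mul_sum]
  simp

theorem evolve_cesaro_le (P : X → PMF X) (ν : PMF X) (n : ℕ) (w : X) :
    evolve P (cesaro P ν n) w ≤ cesaro P ν n w + (n + 1 : ℝ≥0∞)⁻¹ := by
  have hshift : ∑ k ∈ Finset.range (n + 1), lawAt P ν (k + 1) w ≤
      ∑ k ∈ Finset.range (n + 1), lawAt P ν k w + 1 := by
    calc ∑ k ∈ Finset.range (n + 1), lawAt P ν (k + 1) w
        ≤ ∑ k ∈ Finset.range (n + 1), lawAt P ν (k + 1) w + lawAt P ν 0 w := le_self_add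
      _ = ∑ k ∈ Finset.range (n + 1), lawAt P ν k w + lawAt P ν (n + 1) w := by
        rw [← Finset.sum_range_succ' (fun k => lawAt P ν k w), Finset.sum_range_succ]
      _ ≤ ∑ k ∈ Finset.range (n + 1), lawAt P ν k w + 1 := by gcongr; exact PMF.coe_le_one _ _
  calc evolve P (cesaro P ν n) w
      = (n + 1 : ℝ≥0∞)⁻¹ * ∑ k ∈ Finset.range (n + 1), lawAt P ν (k + 1) w := by
        refine (expect_cesaro P ν n fun z => P z w).trans ?_
        simp only [lawAt_succ, PMF.bind_apply, expect]
    _ ≤ (n + 1 : ℝ≥0∞)⁻¹ * (∑ k ∈ Finset.range (n + 1), lawAt P ν k w + 1) := by gcongr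
    _ = cesaro P ν n w + (n + 1 : ℝ≥0∞)⁻¹ := by rw [cesaro_apply, mul_add, mul_one]

/-- A family of laws is tight for the discrete topology: finite sets carry almost all the mass,
uniformly in the family. -/
def IsTight {ι : Type*} (c : ι → PMF X) : Prop :=
  ∀ r < (1 : ℝ≥0∞), ∃ K : Finset X, ∀ i, r ≤ ∑ z ∈ K, c i z

theorem IsTight.exists_tendsto {ι : Type*} {c : ι → PMF X} (hc : IsTight c) (g : Ultrafilter ι) :
    ∃ ρ : PMF X, ∀ z, Tendsto (fun i => c i z) g (𝓝 (ρ z)) := by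
  have hlim : ∀ z, ∃ a, Tendsto (fun i => c i z) g (𝓝 a) := fun z => by
    obtain ⟨a, -, ha⟩ := isCompact_univ.ultrafilter_le_nhds (g.map fun i => c i z) (by simp)
    exact ⟨a, ha⟩
  choose r hr using hlim
  have hK (K : Finset X) : Tendsto (fun i => ∑ z ∈ K, c i z) g (𝓝 (∑ z ∈ K, r z)) :=
    tendsto_finsetSum K fun z _ => hr z
  have hle : ∑' z, r z ≤ 1 := by
    rw [ENNReal.tsum_eq_iSup_sum]
    exact iSup_le fun K => le_of_tendsto' (hK K) fun i =>
      (ENNReal.sum_le_tsum K).trans (c i).tsum_coe.le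
  have hge : 1 ≤ ∑' z, r z := le_of_forall_lt_imp_le_of_dense fun a ha => by
    obtain ⟨K, h⟩ := hc a ha
    exact (ge_of_tendsto' (hK K) h).trans (ENNReal.sum_le_tsum K)
  exact ⟨⟨r, hle.antisymm hge ▸ ENNReal.summable.hasSum⟩, hr⟩

theorem isStationary_of_tendsto_cesaro {ν ρ : PMF X} {g : Filter ℕ} [g.NeBot] (hg : g ≤ atTop)
    (h : ∀ z, Tendsto (fun n => cesaro P ν n z) g (𝓝 (ρ z))) : IsStationary P ρ := by
  refine eq_of_forall_apply_le fun w => ?_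
  rw [PMF.bind_apply, ENNReal.tsum_eq_iSup_sum]
  refine iSup_le fun K => ?_
  have hinv : Tendsto (fun n : ℕ => (n + 1 : ℝ≥0∞)⁻¹) g (𝓝 0) := by
    refine Tendsto.mono_left ?_ hg
    simpa using (tendsto_add_atTop_iff_nat 1).2 ENNReal.tendsto_inv_nat_nhds_zero
  have hlhs : Tendsto (fun n => ∑ z ∈ K, cesaro P ν n z * P z w) g (𝓝 (∑ z ∈ K, ρ z * P z w)) :=
    tendsto_finsetSum K fun z _ => ENNReal.Tendsto.mul_const (h z) (Or.inr (PMF.apply_ne_top _ _))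
  have hrhs := (h w).add hinv
  rw [add_zero] at hrhs
  exact le_of_tendsto_of_tendsto' hlhs hrhs fun n =>
    (ENNReal.sum_le_tsum K).trans (evolve_cesaro_le P ν n w)

theorem tendsto_toProbabilityMeasure [TopologicalSpace X] [MeasurableSpace X]
    [OpensMeasurableSpace X] [MeasurableSingletonClass X] {c : ℕ → PMF X} {p : PMF X}
    (h : ∀ z, p z ≤ liminf (fun n => c n z) atTop) :
    Tendsto (fun n => toProbabilityMeasure (c n)) atTop (𝓝 (toProbabilityMeasure p)) := by
  refine tendsto_of_forall_isOpen_le_liminf' fun G _ => ?_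
  change p.toMeasure G ≤ liminf (fun n => (c n).toMeasure G) atTop
  simp only [PMF.toMeasure_apply_eq_tsum]
  refine (ENNReal.tsum_le_tsum fun z => ?_).trans (tsum_liminf_le fun n => G.indicator (c n))
  by_cases hz : z ∈ G
  · simpa [hz] using h z
  · simp [hz]

theorem le_liminf_bind_apply {Y : Type*} (ν : PMF Y) {c : Y → ℕ → PMF X} {p : PMF X} {w : X}
    (h : ∀ z, Tendsto (fun n => c z n w) atTop (𝓝 (p w))) :
    p w ≤ liminf (fun n => (ν.bind fun z => c z n) w) atTop := by
  have hlim (z : Y) : liminf (fun n => ν z * c z n w) atTop = ν z * p w :=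
    (ENNReal.Tendsto.const_mul (h z) (Or.inr (ν.apply_ne_top z))).liminf_eq
  calc p w = ∑' z, liminf (fun n => ν z * c z n w) atTop := by
        simp only [hlim, ENNReal.tsum_mul_right, ν.tsum_coe, one_mul]
    _ ≤ liminf (fun n => ∑' z, ν z * c z n w) atTop :=
        tsum_liminf_le fun n z => ν z * c z n w

theorem isStable_of_isTight [TopologicalSpace X] [MeasurableSpace X] [OpensMeasurableSpace X]
    [MeasurableSingletonClass X] {z₀ : X} (hz₀ : ∀ z, Relation.ReflTransGen (Linked P) z z₀)
    (ht : ∀ z, IsTight (cesaro P (PMF.pure z))) : IsStable P := by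
  obtain ⟨g, hg⟩ := Filter.exists_ultrafilter_le (atTop : Filter ℕ)
  obtain ⟨p, hp⟩ := (ht z₀).exists_tendsto g
  have hpP : IsStationary P p := isStationary_of_tendsto_cesaro hg hp
  have hlim (z w : X) : Tendsto (fun n => cesaro P (PMF.pure z) n w) atTop (𝓝 (p w)) := by
    rw [tendsto_iff_ultrafilter]
    intro g hg
    obtain ⟨q, hq⟩ := (ht z).exists_tendsto g
    rw [stationary_unique hz₀ hpP (isStationary_of_tendsto_cesaro hg hq)]
    exact hq w
  refine ⟨p, hpP, fun q hq => stationary_unique hz₀ hq hpP, fun ν => ?_⟩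
  refine tendsto_toProbabilityMeasure fun w => ?_
  simp only [cesaro_eq_bind P ν]
  exact le_liminf_bind_apply ν fun z => hlim z w

end Cesaro

/-! ### The drift criterion -/

section DriftCriterion

variable {X : Type*} {P : X → PMF X} {L V : X → ℝ≥0∞} {B : ℝ≥0∞}

theorem expect_lawAt_add_sum_le (hdrift : ∀ z, expect (P z) L + V z ≤ L z + B) (ν : PMF X)
    (n : ℕ) : expect (lawAt P ν n) L + ∑ k ∈ Finset.range n, expect (lawAt P ν k) V ≤
      expect ν L + n * B := by
  have hstep (k : ℕ) : expect (lawAt P ν (k + 1)) L + expect (lawAt P ν k) V ≤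
      expect (lawAt P ν k) L + B := by
    rw [lawAt_succ, expect_bind, ← expect_add, ← expect_const (lawAt P ν k) B, ← expect_add]
    exact expect_mono fun z _ => by simpa [expect_const] using hdrift z
  induction n with
  | zero => simp [lawAt]
  | succ n ih =>
    calc expect (lawAt P ν (n + 1)) L + ∑ k ∈ Finset.range (n + 1), expect (lawAt P ν k) V
        = expect (lawAt P ν (n + 1)) L + expect (lawAt P ν n) V +
            ∑ k ∈ Finset.range n, expect (lawAt P ν k) V := by
          rw [Finset.sum_range_succ]; ring
      _ ≤ expect (lawAt P ν n) L + B + ∑ k ∈ Finset.range n, expect (lawAt P ν k) V := by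
          grw [hstep n]
      _ = expect (lawAt P ν n) L + ∑ k ∈ Finset.range n, expect (lawAt P ν k) V + B := by ring
      _ ≤ expect ν L + n * B + B := by gcongr
      _ = expect ν L + (n + 1 : ℕ) * B := by push_cast; ring

theorem expect_cesaro_le (hdrift : ∀ z, expect (P z) L + V z ≤ L z + B) (ν : PMF X) (n : ℕ) :
    expect (cesaro P ν n) V ≤ expect ν L + B := by
  rw [expect_cesaro, mul_comm, ← div_eq_mul_inv]
  refine ENNReal.div_le_of_le_mul ?_
  calc ∑ k ∈ Finset.range (n + 1), expect (lawAt P ν k) V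
      ≤ expect ν L + (n + 1 : ℕ) * B := le_add_self.trans (expect_lawAt_add_sum_le hdrift ν _)
    _ ≤ (n + 1 : ℕ) * expect ν L + (n + 1 : ℕ) * B := by
        gcongr
        exact le_mul_of_one_le_left' (by simp)
    _ = (expect ν L + B) * (n + 1) := by push_cast; ring

theorem le_expect_add_mul_sum (p : PMF X) {N : ℝ≥0∞} {K : Finset X}
    (hK : ∀ z ∉ K, N ≤ V z) : N ≤ expect p V + N * ∑ z ∈ K, p z := by
  rw [← expect_indicator_one, ← expect_const_mul, ← expect_add]
  conv_lhs => rw [← expect_const p N]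
  refine expect_mono fun z _ => ?_
  by_cases hz : z ∈ K
  · simp [hz]
  · simpa [hz] using hK z hz

theorem isTight_cesaro_of_drift (hdrift : ∀ z, expect (P z) L + V z ≤ L z + B) (hB : B ≠ ∞)
    (hV : ∀ N : ℕ, {z | V z < N}.Finite) {ν : PMF X} (hν : expect ν L ≠ ∞) :
    IsTight (cesaro P ν) := by
  intro r hr
  obtain ⟨N, hN⟩ := ENNReal.exists_nat_mul_gt (tsub_pos_of_lt hr).ne'
    (ENNReal.add_ne_top.2 ⟨hν, hB⟩)
  refine ⟨(hV N).toFinset, fun n => not_lt.1 fun hlt => ?_⟩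
  have hMarkov := le_expect_add_mul_sum (V := V) (cesaro P ν n) (N := N)
    (K := (hV N).toFinset) (by simp)
  refine hMarkov.not_gt ?_
  calc expect (cesaro P ν n) V + N * ∑ z ∈ (hV N).toFinset, cesaro P ν n z
      ≤ expect ν L + B + N * r := by
        gcongr
        exact expect_cesaro_le hdrift ν n
    _ < N * (1 - r) + N * r := ENNReal.add_lt_add_right (by finiteness) hN
    _ = N := by rw [← mul_add, tsub_add_cancel_of_le hr.le, mul_one]

end DriftCriterion

/-! ### Submartingales along a stationary chain -/

section Submartingale

variable {X Ω : Type*}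

theorem expect_tsub_add (p : PMF Ω) (a b : Ω → ℝ≥0∞) :
    expect p (fun ω => a ω - b ω) + expect p b = expect p fun ω => max (a ω) (b ω) := by
  simp only [← expect_add, tsub_add_eq_max]

theorem expect_tsub_le_of_expect_le {p : PMF Ω} {a b : Ω → ℝ≥0∞} (hab : expect p a ≤ expect p b)
    (hb : expect p b ≠ ∞) : expect p (fun ω => a ω - b ω) ≤ expect p fun ω => b ω - a ω := by
  refine (ENNReal.add_le_add_iff_right hb).1 ?_
  calc expect p (fun ω => a ω - b ω) + expect p b
      = expect p (fun ω => b ω - a ω) + expect p a := by simp only [expect_tsub_add, max_comm]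
    _ ≤ expect p (fun ω => b ω - a ω) + expect p b := by gcongr

theorem min_tsub_min_le (x y N : ℝ≥0∞) : min x N - min y N ≤ x - y := by
  rw [tsub_le_iff_right]
  rcases le_total y N with h | h
  · rw [min_eq_left h]
    exact (min_le_left _ _).trans le_tsub_add
  · rw [min_eq_right h]
    exact (min_le_right _ _).trans le_add_self

theorem expect_tsub_le_of_map_eq {p : PMF Ω} {a b : Ω → ℝ≥0} (hab : p.map a = p.map b) :
    expect p (fun ω => (a ω - b ω : ℝ≥0∞)) ≤ expect p fun ω => (b ω - a ω : ℝ≥0∞) := by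
  have htrunc (N : ℝ≥0) : expect p (fun ω => min (a ω : ℝ≥0∞) N - min (b ω : ℝ≥0∞) N) ≤
      expect p fun ω => (b ω - a ω : ℝ≥0∞) := by
    refine (expect_tsub_le_of_expect_le (le_of_eq ?_) ?_).trans
      (expect_mono fun ω _ => min_tsub_min_le _ _ _)
    · rw [← expect_map p a fun x => min (x : ℝ≥0∞) N, hab, expect_map]
    · refine ne_top_of_le_ne_top (b := (N : ℝ≥0∞)) (by simp) ?_
      exact (expect_mono fun ω _ => min_le_right _ _).trans (expect_const p N).le
  rw [expect, ENNReal.tsum_eq_iSup_sum]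
  refine iSup_le fun K => ?_
  refine le_trans ?_ ((ENNReal.sum_le_tsum K).trans (htrunc (K.sup a)))
  refine Finset.sum_le_sum fun ω hω => mul_le_mul_right ?_ _
  refine tsub_le_tsub ?_ (min_le_left _ _)
  rw [min_eq_left (by exact_mod_cast Finset.le_sup hω)]

theorem IsStationary.expect_tsub_comm {P : X → PMF X} {p : PMF X} (hp : IsStationary P p)
    (g : X → ℝ≥0) : (expect p fun z => expect (P z) fun w => (g z - g w : ℝ≥0∞)) =
      expect p fun z => expect (P z) fun w => (g w - g z : ℝ≥0∞) := by
  set Q : PMF (X × X) := p.bind fun z => (P z).map (Prod.mk z)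
  have hfst : Q.map (fun zw => g zw.1) = p.map g := by
    simp [Q, Function.comp_def, ← PMF.bind_pure_comp]
  have hsnd : Q.map (fun zw => g zw.2) = p.map g := by
    conv_rhs => rw [← hp]
    simp [Q, PMF.map_bind, PMF.map_comp, Function.comp_def]
  have h := (expect_tsub_le_of_map_eq (hfst.trans hsnd.symm)).antisymm
    (expect_tsub_le_of_map_eq (hsnd.trans hfst.symm))
  simpa only [Q, expect_bind, expect_map] using h

/-- `E f⁻ ≤ E f⁺`: for an integrable function, this says that its mean is non-negative. -/
def HasNonnegMean (p : PMF Ω) (f : Ω → ℝ) : Prop :=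
  expect p (fun ω => .ofReal (-f ω)) ≤ expect p fun ω => .ofReal (f ω)

theorem hasNonnegMean_sub {p : PMF Ω} {a b : Ω → ℝ≥0}
    (hba : expect p (fun ω => b ω) ≤ expect p fun ω => a ω) (ha : expect p (fun ω => a ω) ≠ ∞) :
    HasNonnegMean p fun ω => (a ω - b ω : ℝ) := by
  simpa [HasNonnegMean, ENNReal.ofReal_sub] using expect_tsub_le_of_expect_le hba ha

theorem HasNonnegMean.bind {A : Type*} {μ : PMF A} {q : A → PMF X} {b : A → ℝ} {f : X → ℝ}
    (hb : HasNonnegMean μ b) (hbf : ∀ a w, q a w ≠ 0 → b a ≤ f w) :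
    HasNonnegMean (μ.bind q) f := by
  simp only [HasNonnegMean, expect_bind] at hb ⊢
  calc (expect μ fun a => expect (q a) fun w => .ofReal (-f w))
      ≤ expect μ fun a => .ofReal (-b a) := expect_mono fun a _ =>
        (expect_mono fun w hw => ENNReal.ofReal_le_ofReal (neg_le_neg (hbf a w hw))).trans
          (expect_const (q a) _).le
    _ ≤ expect μ fun a => .ofReal (b a) := hb
    _ ≤ expect μ fun a => expect (q a) fun w => .ofReal (f w) := expect_mono fun a _ =>
        (expect_const (q a) _).ge.trans
          (expect_mono fun w hw => ENNReal.ofReal_le_ofReal (hbf a w hw))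

theorem HasNonnegMean.eq_zero_of_nonpos {p : PMF Ω} {f : Ω → ℝ} (hf : HasNonnegMean p f)
    (hf' : ∀ ω, p ω ≠ 0 → f ω ≤ 0) {ω : Ω} (hω : p ω ≠ 0) : f ω = 0 := by
  have hpos : expect p (fun ω => .ofReal (f ω)) = 0 :=
    expect_eq_zero_iff.2 fun ω hω => ENNReal.ofReal_of_nonpos (hf' ω hω)
  have hneg := expect_eq_zero_iff.1 (le_zero_iff.1 (hf.trans hpos.le)) ω hω
  rw [ENNReal.ofReal_eq_zero, neg_nonpos] at hneg
  exact (hf' ω hω).antisymm hneg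

theorem ofReal_sub_tsub_le (x y k : ℝ) :
    ENNReal.ofReal (x - k) - ENNReal.ofReal (y - k) ≤ ENNReal.ofReal (x - y) := by
  rw [tsub_le_iff_right]
  simpa using ENNReal.ofReal_add_le (p := x - y) (q := y - k)

theorem HasNonnegMean.expect_posPart_tsub_le {p : PMF Ω} {f : Ω → ℝ} {c : ℝ}
    (hf : HasNonnegMean p fun ω => f ω - c) (k : ℝ) :
    expect p (fun ω => .ofReal (c - k) - .ofReal (f ω - k)) ≤
      expect p fun ω => .ofReal (f ω - k) - .ofReal (c - k) := by
  rcases le_total c k with hck | hkc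
  · simp [ENNReal.ofReal_of_nonpos (sub_nonpos.2 hck), expect_const]
  · calc expect p (fun ω => .ofReal (c - k) - .ofReal (f ω - k))
        ≤ expect p fun ω => .ofReal (-(f ω - c)) := expect_mono fun ω _ => by
          rw [neg_sub]
          exact ofReal_sub_tsub_le _ _ _
      _ ≤ expect p fun ω => .ofReal (f ω - c) := hf
      _ = expect p fun ω => .ofReal (f ω - k) - .ofReal (c - k) := by
          congr 1 with ω
          rw [← ENNReal.ofReal_sub _ (sub_nonneg.2 hkc), sub_sub_sub_cancel_right]

theorem IsStationary.eq_of_submartingale {P : X → PMF X} {p : PMF X} (hp : IsStationary P p)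
    {f : X → ℝ} (hf : ∀ z, HasNonnegMean (P z) fun w => f w - f z)
    (hfin : (expect p fun z => expect (P z) fun w => .ofReal (f z - f w)) ≠ ∞)
    {z w : X} (hz : p z ≠ 0) (hw : P z w ≠ 0) : f w = f z := by
  -- `(f - k)⁺` is a submartingale as well; at the level `k = f z`, it cannot decrease from `z`.
  have hup : ∀ w, P z w ≠ 0 → f w - f z ≤ 0 := fun w hw => by
    have hbalance := hp.expect_tsub_comm fun w => (f w - f z).toNNReal
    have hdec := ne_top_of_le_ne_top hfin <| expect_mono fun v _ =>
      expect_mono (p := P v) fun w _ => ofReal_sub_tsub_le (f v) (f w) (f z)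
    have heq := eq_of_le_of_expect_le (fun v => (hf v).expect_posPart_tsub_le (f z)) hdec
      hbalance.ge hz
    simp only [sub_self, ENNReal.ofReal_zero, zero_tsub, expect_const, tsub_zero] at heq
    exact ENNReal.ofReal_eq_zero.1 (expect_eq_zero_iff.1 heq.symm w hw)
  exact sub_eq_zero.1 ((hf z).eq_zero_of_nonpos hup hw)

theorem le_of_lawAt_ne_zero {P : X → PMF X} {f : X → ℝ} (hf : ∀ z w, P z w ≠ 0 → f z ≤ f w)
    (z : X) {n : ℕ} {w : X} (hw : lawAt P (PMF.pure z) n w ≠ 0) : f z ≤ f w := by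
  induction n generalizing w with
  | zero =>
    obtain rfl : w = z := by simpa [lawAt] using hw
    exact le_rfl
  | succ n ih =>
    rw [lawAt_succ, ← PMF.mem_support_iff, PMF.mem_support_bind_iff] at hw
    obtain ⟨v, hv, hvw⟩ := hw
    exact (ih hv).trans (hf v w hvw)

variable [TopologicalSpace X] [DiscreteTopology X] [MeasurableSpace X] [OpensMeasurableSpace X]

theorem not_isAttractive_of_monotone {P : X → PMF X} {f : X → ℝ}
    (hf : ∀ z w, P z w ≠ 0 → f z ≤ f w) (hunb : ∀ v, ∃ z, f v < f z) (p : PMF X) :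
    ¬ IsAttractive P p := by
  intro hatt
  obtain ⟨v, hv⟩ := p.support_nonempty
  obtain ⟨z, hz⟩ := hunb v
  have hmass (q : PMF X) : (toProbabilityMeasure q : Measure X) {v} = q v :=
    q.toMeasure_apply_singleton v (isOpen_discrete _).measurableSet
  have hzero (n : ℕ) : cesaro P (PMF.pure z) n v = 0 := by
    rw [cesaro_apply, Finset.sum_eq_zero, mul_zero]
    exact fun k _ => not_not.1 fun h => (le_of_lawAt_ne_zero hf z h).not_gt hz
  have hle := ProbabilityMeasure.le_liminf_measure_open_of_tendsto (hatt (PMF.pure z))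
    (isOpen_discrete {v})
  simp only [hmass, hzero, liminf_const] at hle
  exact hv (le_zero_iff.1 hle)

theorem not_isStable_of_increments {A : Type*} {μ : PMF A} {q : X → A → PMF X} {b : A → ℝ}
    {f : X → ℝ} (hb : HasNonnegMean μ b) (hfin : expect μ (fun a => .ofReal (-b a)) ≠ ∞)
    (hstep : ∀ z a w, q z a w ≠ 0 → b a ≤ f w - f z) (hunb : ∀ v, ∃ z, f v < f z) :
    ¬ IsStable fun z => μ.bind (q z) := by
  rintro ⟨p, hp, -, hatt⟩
  have hsub (z : X) : HasNonnegMean (μ.bind (q z)) fun w => f w - f z := hb.bind (hstep z)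
  have hdec (z : X) : (expect (μ.bind (q z)) fun w => .ofReal (f z - f w)) ≤
      expect μ fun a => .ofReal (-b a) := by
    rw [expect_bind]
    refine expect_mono fun a _ => (expect_mono fun w hw => ?_).trans (expect_const (q z a) _).le
    exact ENNReal.ofReal_le_ofReal (by linarith [hstep z a w hw])
  have hconst := fun z w => hp.eq_of_submartingale (z := z) (w := w) hsub <| ne_top_of_le_ne_top
    hfin ((expect_mono fun z _ => hdec z).trans (expect_const p _).le)
  obtain ⟨z, hz⟩ := p.support_nonempty
  have hmem {z : X} {a : A} {w : X} (ha : μ a ≠ 0) (hw : q z a w ≠ 0) : (μ.bind (q z)) w ≠ 0 :=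
    (PMF.mem_support_bind_iff _ _ _).2 ⟨a, ha, hw⟩
  have hb0 (a : A) (ha : μ a ≠ 0) : b a = 0 := by
    refine hb.eq_zero_of_nonpos (fun a ha => ?_) ha
    obtain ⟨w, hw⟩ := (q z a).support_nonempty
    exact (hstep z a w hw).trans (sub_eq_zero.2 (hconst z w hz (hmem ha hw))).le
  refine not_isAttractive_of_monotone (fun z w hw => ?_) hunb p hatt
  obtain ⟨a, ha, haw⟩ := (PMF.mem_support_bind_iff _ _ _).1 hw
  exact sub_nonneg.1 ((hb0 a ha).ge.trans (hstep z a w haw))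

end Submartingale

/-! ### Transitions of the buffer -/

section Transition

section Counting

variable {A : Type*}

theorem addOne_self (x : A → ℕ) (a : A) : addOne x a a = x a + 1 := by
  simp [addOne]

variable [Fintype A]

theorem sum_mul_addOne (u : A → ℝ) (x : A → ℕ) (a : A) :
    ∑ i, u i * addOne x a i = ∑ i, u i * x i + u a := by
  classical
  simp [addOne, mul_add, Finset.sum_add_distrib, Pi.single_apply]

theorem sum_mul_removeOne (u : A → ℝ) (x : A → ℕ) (a : A) (h : 0 < x a) :
    ∑ i, u i * removeOne x a i = ∑ i, u i * x i - u a := by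
  rw [eq_sub_iff_add_eq, ← sum_mul_addOne, addOne_removeOne x a h]

theorem sum_sq_addOne (x : A → ℕ) (a : A) :
    ∑ i, addOne x a i ^ 2 = ∑ i, x i ^ 2 + 2 * x a + 1 := by
  classical
  have h (i : A) : addOne x a i ^ 2 = x i ^ 2 + if i = a then 2 * x a + 1 else 0 := by
    by_cases hi : i = a
    · subst hi
      rw [addOne_self, if_pos rfl]
      ring
    · simp [addOne_of_ne x hi, hi]
  simp only [h, Finset.sum_add_distrib, Finset.sum_ite_eq', Finset.mem_univ, if_true, add_assoc]

theorem sum_sq_removeOne (x : A → ℕ) (a : A) (h : 0 < x a) :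
    ∑ i, removeOne x a i ^ 2 + 2 * x a = ∑ i, x i ^ 2 + 1 := by
  have hsq := sum_sq_addOne (removeOne x a) a
  have hself := addOne_self (removeOne x a) a
  rw [addOne_removeOne x a h] at hsq hself
  omega

theorem sum_sq_addOne_removeOne_le (x : A → ℕ) (a b : A) (h : 0 < x a) :
    ∑ i, addOne (removeOne x a) b i ^ 2 + 2 * x a ≤ ∑ i, x i ^ 2 + 2 * x b + 2 := by
  have hadd := sum_sq_addOne (removeOne x a) b
  have hremove := sum_sq_removeOne x a h
  have hle := removeOne_le x a b
  omega

end Counting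

variable {C S : Type*} [Fintype C] [Fintype S] {E : Set (C × S)}

theorem Policy.step_cases (pol : Policy E) {z w : State E} {a : C × S} (hw : pol.step z a w ≠ 0) :
    (∃ hs hc i j, pol.Φ z.1.1 a.2 hs i ≠ 0 ∧ pol.Ψ z.1.2 a.1 hc j ≠ 0 ∧ w = z.removeBoth i j) ∨
    (∃ hs hc i, pol.Φ z.1.1 a.2 hs i ≠ 0 ∧ w = z.replaceCustomer i a.1 hc) ∨
    (∃ hc hs j, pol.Ψ z.1.2 a.1 hc j ≠ 0 ∧ w = z.replaceServer j a.2 hs) ∨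
    (¬ Nonempty (AvailableCustomers E z.1.1 a.2) ∧ ¬ Nonempty (AvailableServers E z.1.2 a.1) ∧
      a ∈ E ∧ w = z) ∨
    ∃ hE hs hc, w = z.add a.1 a.2 hE hs hc := by
  rw [← PMF.mem_support_iff, Policy.step] at hw
  split_ifs at hw with hs hc hc hE
  · simp only [PMF.mem_support_bind_iff, PMF.mem_support_map_iff] at hw
    obtain ⟨i, hi, j, hj, rfl⟩ := hw
    exact .inl ⟨hs, hc, i, j, hi, hj, rfl⟩
  · obtain ⟨i, hi, rfl⟩ := (PMF.mem_support_map_iff _ _ _).1 hw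
    exact .inr <| .inl ⟨hs, hc, i, hi, rfl⟩
  · obtain ⟨j, hj, rfl⟩ := (PMF.mem_support_map_iff _ _ _).1 hw
    exact .inr <| .inr <| .inl ⟨hc, hs, j, hj, rfl⟩
  · exact .inr <| .inr <| .inr <| .inl ⟨hs, hc, hE, (PMF.mem_support_pure_iff _ _).1 hw⟩
  · exact .inr <| .inr <| .inr <| .inr ⟨hE, hs, hc, (PMF.mem_support_pure_iff _ _).1 hw⟩

end Transition

/-! ### Stability forces NCond -/

section Necessity

theorem sum_lt_one_of_support_eq_univ {A : Type*} {p : PMF A} (hp : p.support = Set.univ)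
    {U : Finset A} {a : A} (ha : a ∉ U) : ∑ i ∈ U, p i < 1 := by
  classical
  have hpa : p a ≠ 0 := (p.mem_support_iff a).1 (hp ▸ Set.mem_univ a)
  calc ∑ i ∈ U, p i < ∑ i ∈ U, p i + p a :=
        ENNReal.lt_add_right (ENNReal.sum_ne_top.2 fun i _ => p.apply_ne_top i) hpa
    _ = ∑ i ∈ insert a U, p i := by rw [Finset.sum_insert ha, add_comm]
    _ ≤ 1 := (ENNReal.sum_le_tsum _).trans_eq p.tsum_coe

theorem indicator_one_le_indicator_one {A B : Type*} {U : Set A} {V : Set B} {a : A} {b : B}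
    (h : a ∈ U → b ∈ V) : (U.indicator 1 a : ℝ≥0) ≤ V.indicator 1 b := by
  refine Set.indicator_apply_le' (fun ha => ?_) fun _ => zero_le
  simp [h ha]

theorem mem_serversOf {C S : Type*} [Fintype S] {E : Set (C × S)} {U : Finset C} {s : S} :
    s ∈ serversOf E U ↔ ∃ c ∈ U, (c, s) ∈ E := by
  simp [serversOf]

theorem mem_customersOf {C S : Type*} [Fintype C] {E : Set (C × S)} {V : Finset S} {c : C} :
    c ∈ customersOf E V ↔ ∃ s ∈ V, (c, s) ∈ E := by
  simp [customersOf]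

variable {C S : Type*} [Fintype C] [Fintype S] {E : Set (C × S)}

/-- The imbalance between the customers with weights `u` and the servers with weights `v`. When the
weight of a customer is at most that of each server it can be matched with, no match decreases
it. -/
def imbalance (u : C → ℝ) (v : S → ℝ) (z : State E) : ℝ :=
  ∑ c, u c * z.1.1 c - ∑ s, v s * z.1.2 s

theorem Policy.sub_le_imbalance_sub (pol : Policy E) {u : C → ℝ} {v : S → ℝ}
    (huv : ∀ c s, (c, s) ∈ E → u c ≤ v s) {z w : State E} {a : C × S} (hw : pol.step z a w ≠ 0) :
    u a.1 - v a.2 ≤ imbalance u v w - imbalance u v z := by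
  rcases pol.step_cases hw with ⟨hs, hc, i, j, -, -, rfl⟩ | ⟨hs, hc, i, -, rfl⟩ |
    ⟨hc, hs, j, -, rfl⟩ | ⟨-, -, ha, rfl⟩ | ⟨hE, hs, hc, rfl⟩
  · simp only [imbalance, State.removeBoth, sum_mul_removeOne u z.1.1 i i.2.2,
      sum_mul_removeOne v z.1.2 j j.2.2]
    linarith [huv _ _ i.2.1, huv _ _ j.2.1]
  · simp only [imbalance, State.replaceCustomer, sum_mul_addOne,
      sum_mul_removeOne u z.1.1 i i.2.2]
    linarith [huv _ _ i.2.1]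
  · simp only [imbalance, State.replaceServer, sum_mul_addOne,
      sum_mul_removeOne v z.1.2 j j.2.2]
    linarith [huv _ _ j.2.1]
  · linarith [huv _ _ ha]
  · simp only [imbalance, State.add, sum_mul_addOne]
    linarith

theorem exists_imbalance_eq {c : C} {s : S} (hcs : (c, s) ∉ E) (u : C → ℝ) (v : S → ℝ) (k : ℕ) :
    ∃ z : State E, imbalance u v z = k * (u c - v s) := by
  classical
  refine ⟨⟨(Pi.single c k, Pi.single s k), by simp, fun d t hdt => ?_⟩, ?_⟩
  · by_cases hd : d = c
    · have ht : t ≠ s := fun ht => hcs (hd ▸ ht ▸ hdt)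
      simp [ht]
    · simp [hd]
  · simp only [imbalance, Pi.single_apply, Nat.cast_ite, Nat.cast_zero, mul_ite, mul_zero,
      Finset.sum_ite_eq', Finset.mem_univ, if_true]
    ring

theorem Policy.not_hasNonnegMean_of_isStable (pol : Policy E) {μ : PMF (C × S)}
    (hst : IsStable (pol.chain μ)) {u : C → ℝ} {v : S → ℝ}
    (huv : ∀ c s, (c, s) ∈ E → u c ≤ v s) {c : C} {s : S} (hcs : v s < u c) :
    ¬ HasNonnegMean μ fun a => u a.1 - v a.2 := by
  refine fun h => not_isStable_of_increments h (expect_ne_top μ fun _ => ENNReal.ofReal_ne_top)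
    (fun z a w => pol.sub_le_imbalance_sub huv) (fun z => ?_) hst
  obtain ⟨k, hk⟩ := exists_nat_gt (imbalance u v z / (u c - v s))
  obtain ⟨w, hw⟩ := exists_imbalance_eq (fun h => hcs.not_ge (huv c s h)) u v k
  exact ⟨w, hw ▸ (div_lt_iff₀ (sub_pos.2 hcs)).1 hk⟩

theorem Policy.sum_lt_sum_serversOf_of_isStable (pol : Policy E) {μ : PMF (C × S)}
    (hst : IsStable (pol.chain μ)) {U : Finset C} {c : C} {s : S} (hc : c ∈ U)
    (hs : s ∉ serversOf E U) :
    ∑ c ∈ U, μ.map Prod.fst c < ∑ s ∈ serversOf E U, μ.map Prod.snd s := by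
  by_contra! hle
  rw [sum_map_apply, sum_map_apply] at hle
  refine pol.not_hasNonnegMean_of_isStable hst
    (u := fun c => ((U : Set C).indicator 1 c : ℝ≥0))
    (v := fun s => ((serversOf E U : Set S).indicator 1 s : ℝ≥0))
    (fun d t hdt => ?_) (c := c) (s := s) (by simp [hc, hs])
    (hasNonnegMean_sub hle (expect_ne_top μ fun _ => ENNReal.coe_ne_top))
  exact NNReal.coe_le_coe.2 (indicator_one_le_indicator_one fun hd =>
    Finset.mem_coe.2 (mem_serversOf.2 ⟨d, hd, hdt⟩))

theorem Policy.sum_lt_sum_customersOf_of_isStable (pol : Policy E) {μ : PMF (C × S)}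
    (hst : IsStable (pol.chain μ)) {V : Finset S} {c : C} {s : S} (hs : s ∈ V)
    (hc : c ∉ customersOf E V) :
    ∑ s ∈ V, μ.map Prod.snd s < ∑ c ∈ customersOf E V, μ.map Prod.fst c := by
  by_contra! hle
  rw [sum_map_apply, sum_map_apply] at hle
  refine pol.not_hasNonnegMean_of_isStable hst
    (u := fun c => -(((customersOf E V : Set C).indicator 1 c : ℝ≥0) : ℝ))
    (v := fun s => -(((V : Set S).indicator 1 s : ℝ≥0) : ℝ))
    (fun d t hdt => ?_) (c := c) (s := s) (by simp [hc, hs]) ?_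
  · exact neg_le_neg (NNReal.coe_le_coe.2 (indicator_one_le_indicator_one fun ht =>
      Finset.mem_coe.2 (mem_customersOf.2 ⟨t, ht, hdt⟩)))
  · simp only [neg_sub_neg]
    exact hasNonnegMean_sub hle (expect_ne_top μ fun _ => ENNReal.coe_ne_top)

theorem Policy.ncond_of_isStable (pol : Policy E) {μ : PMF (C × S)} (hμ : HasFullMarginals μ)
    (hst : IsStable (pol.chain μ)) : NCond E (μ.map Prod.fst) (μ.map Prod.snd) := by
  constructor
  · rintro U ⟨c, hc⟩ hU
    by_cases hall : serversOf E U = Finset.univ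
    · obtain ⟨d, hd⟩ := not_forall.1 (mt Finset.eq_univ_iff_forall.2 hU)
      rw [hall, ← tsum_fintype (L := .unconditional S), PMF.tsum_coe]
      exact sum_lt_one_of_support_eq_univ hμ.1 hd
    · obtain ⟨s, hs⟩ := not_forall.1 (mt Finset.eq_univ_iff_forall.2 hall)
      exact pol.sum_lt_sum_serversOf_of_isStable hst hc hs
  · rintro V ⟨s, hs⟩ hV
    by_cases hall : customersOf E V = Finset.univ
    · obtain ⟨t, ht⟩ := not_forall.1 (mt Finset.eq_univ_iff_forall.2 hV)
      rw [hall, ← tsum_fintype (L := .unconditional C), PMF.tsum_coe]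
      exact sum_lt_one_of_support_eq_univ hμ.2 ht
    · obtain ⟨c, hc⟩ := not_forall.1 (mt Finset.eq_univ_iff_forall.2 hall)
      exact pol.sum_lt_sum_customersOf_of_isStable hst hs hc

end Necessity

/-! ### Reaching the empty buffer -/

section Reachability

variable {C S : Type*} [Fintype C] [Fintype S] {E : Set (C × S)}

/-- The empty buffer. -/
def emptyState (E : Set (C × S)) : State E := ⟨(0, 0), by simp⟩

theorem eq_emptyState {z : State E} (h : ∑ c, z.1.1 c = 0) : z = emptyState E := by
  have h' := z.2.1 ▸ h
  simp only [Finset.sum_eq_zero_iff, Finset.mem_univ, true_implies] at h h'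
  exact Subtype.ext (Prod.ext (funext h) (funext h'))

theorem eq_univ_of_closed {μ : PMF (C × S)} (h : NCond E (μ.map Prod.fst) (μ.map Prod.snd))
    {U : Finset C} (hU : U.Nonempty)
    (hclosed : ∀ c ∈ U, ∀ d s, (c, s) ∈ E → μ (d, s) ≠ 0 → d ∈ U) : U = Finset.univ := by
  by_contra hne
  refine (h.1 U hU hne).not_ge ?_
  rw [sum_map_apply, sum_map_apply]
  refine expect_mono fun a ha => ENNReal.coe_le_coe.2 ?_
  refine indicator_one_le_indicator_one fun hs => ?_
  obtain ⟨c, hc, hcs⟩ := mem_serversOf.1 (Finset.mem_coe.1 hs)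
  exact Finset.mem_coe.2 (hclosed c hc a.1 a.2 hcs ha)

theorem exists_mem_of_ncond {μ : PMF (C × S)} (h : NCond E (μ.map Prod.fst) (μ.map Prod.snd))
    (hE : E.Nonempty) : (∀ c, ∃ s, (c, s) ∈ E) ∧ ∀ s, ∃ c, (c, s) ∈ E := by
  obtain ⟨⟨c₀, s₀⟩, h₀⟩ := hE
  refine ⟨fun c => ?_, fun s => ?_⟩
  · by_cases hc : {c} = (Finset.univ : Finset C)
    · exact ⟨s₀, Finset.mem_singleton.1 (hc ▸ Finset.mem_univ c₀) ▸ h₀⟩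
    · obtain ⟨s, hs, -⟩ := Finset.exists_ne_zero_of_sum_ne_zero
        (h.1 {c} (Finset.singleton_nonempty c) hc).ne_bot
      exact ⟨s, by simpa [mem_serversOf] using hs⟩
  · by_cases hs : {s} = (Finset.univ : Finset S)
    · exact ⟨c₀, Finset.mem_singleton.1 (hs ▸ Finset.mem_univ s₀) ▸ h₀⟩
    · obtain ⟨c, hc, -⟩ := Finset.exists_ne_zero_of_sum_ne_zero
        (h.2 {s} (Finset.singleton_nonempty s) hs).ne_bot
      exact ⟨c, by simpa [mem_customersOf] using hc⟩

theorem Policy.chain_ne_zero_iff (pol : Policy E) {μ : PMF (C × S)} {z w : State E} :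
    pol.chain μ z w ≠ 0 ↔ ∃ a, μ a ≠ 0 ∧ pol.step z a w ≠ 0 := by
  rw [← PMF.mem_support_iff, Policy.chain, PMF.mem_support_bind_iff]
  rfl

theorem Policy.exists_linked_of_available (pol : Policy E) {μ : PMF (C × S)} {z : State E}
    {c d : C} {s : S} (hc : 0 < z.1.1 c) (hcs : (c, s) ∈ E) (hd : μ (d, s) ≠ 0) :
    ∃ w : State E, Linked (pol.chain μ) z w ∧ (∑ c, w.1.1 c < ∑ c, z.1.1 c ∨
      0 < w.1.1 d ∧ w.1.2 = z.1.2) := by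
  obtain ⟨w, hw⟩ := (pol.step z (d, s)).support_nonempty
  refine ⟨w, pol.chain_ne_zero_iff.2 ⟨_, hd, hw⟩, ?_⟩
  have hs : Nonempty (AvailableCustomers E z.1.1 s) := ⟨c, hcs, hc⟩
  rcases pol.step_cases hw with ⟨-, -, i, j, -, -, rfl⟩ | ⟨-, hc, i, -, rfl⟩ |
    ⟨-, hs', -⟩ | ⟨hs', -⟩ | ⟨-, hs', -⟩
  · left
    have := sum_removeOne z.1.1 i i.2.2
    simp only [State.removeBoth]
    omega
  · right
    simp [State.replaceCustomer, addOne_self]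
  all_goals exact absurd hs hs'

theorem Policy.exists_reachable_lt (pol : Policy E) {μ : PMF (C × S)}
    (h : NCond E (μ.map Prod.fst) (μ.map Prod.snd)) (hE : ∀ s, ∃ c, (c, s) ∈ E) {z : State E}
    (hz : 0 < ∑ c, z.1.1 c) :
    ∃ w, Relation.ReflTransGen (Linked (pol.chain μ)) z w ∧ ∑ c, w.1.1 c < ∑ c, z.1.1 c := by
  classical
  by_contra! hmin
  obtain ⟨c₀, -, hc₀⟩ := Finset.exists_ne_zero_of_sum_ne_zero hz.ne'
  obtain ⟨s₀, -, hs₀⟩ := Finset.exists_ne_zero_of_sum_ne_zero (z.2.1 ▸ hz.ne')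
  let U : Finset C := {c | ∃ w, Relation.ReflTransGen (Linked (pol.chain μ)) z w ∧
    w.1.2 = z.1.2 ∧ 0 < w.1.1 c}
  have hU : U = Finset.univ := by
    refine eq_univ_of_closed h ⟨c₀, ?_⟩ fun c hc d s hcs hd => ?_
    · exact (Finset.mem_filter_univ c₀).2 ⟨z, .refl, rfl, Nat.pos_of_ne_zero hc₀⟩
    · simp only [U, Finset.mem_filter_univ] at hc ⊢
      obtain ⟨w, hzw, hwz, hwc⟩ := hc
      obtain ⟨v, hwv, hv | ⟨hvd, hvw⟩⟩ := pol.exists_linked_of_available hwc hcs hd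
      · rw [w.2.1, hwz, ← z.2.1] at hv
        exact absurd hv (hmin v (hzw.tail hwv)).not_gt
      · exact ⟨v, hzw.tail hwv, hvw.trans hwz, hvd⟩
  obtain ⟨c, hc⟩ := hE s₀
  obtain ⟨w, -, hwz, hwc⟩ := (Finset.mem_filter_univ c).1 (hU ▸ Finset.mem_univ c)
  exact mul_ne_zero hwc.ne' (hwz ▸ hs₀) (w.2.2 c s₀ hc)

theorem Policy.reachable_emptyState (pol : Policy E) {μ : PMF (C × S)}
    (h : NCond E (μ.map Prod.fst) (μ.map Prod.snd)) (hE : ∀ s, ∃ c, (c, s) ∈ E) (z : State E) :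
    Relation.ReflTransGen (Linked (pol.chain μ)) z (emptyState E) := by
  induction hn : ∑ c, z.1.1 c using Nat.strong_induction_on generalizing z with
  | _ n ih =>
    rcases Nat.eq_zero_or_pos n with rfl | hpos
    · rw [eq_emptyState hn]
    · obtain ⟨w, hzw, hw⟩ := pol.exists_reachable_lt h hE (hn ▸ hpos)
      exact hzw.trans (ih _ (hn ▸ hw) w rfl)

end Reachability
/-! ### The quadratic Lyapunov function -/

section LongestQueue

variable {A B : Type*} [Fintype A] {R : A → B → Prop}

theorem eventually_sum_add_le {p : A → ℝ≥0∞} {q : B → ℝ≥0∞} {T : Finset A → Finset B}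
    (h : ∀ U : Finset A, U.Nonempty → U ≠ Finset.univ → ∑ a ∈ U, p a < ∑ b ∈ T U, q b) :
    ∀ᶠ δ : ℝ≥0 in 𝓝 0, ∀ U ≠ Finset.univ, ∑ a ∈ U, (p a + δ) ≤ ∑ b ∈ T U, q b := by
  refine eventually_all.2 fun U => ?_
  rcases U.eq_empty_or_nonempty with rfl | hU
  · simp
  by_cases huniv : U = Finset.univ
  · simp [huniv]
  have hcont : Continuous fun δ : ℝ≥0 => ∑ a ∈ U, (p a + δ) := by fun_prop
  filter_upwards [hcont.continuousAt.eventually_lt_const (by simpa using h U hU huniv)]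
    with δ hδ _ using hδ.le

theorem sum_mul_natCast_eq_tsum (p : A → ℝ≥0∞) (x : A → ℕ) :
    ∑ a, p a * x a = ∑' k : ℕ, ∑ a with k < x a, p a := by
  have hcount (n : ℕ) : (n : ℝ≥0∞) = ∑' k : ℕ, if k < n then 1 else 0 := by
    rw [tsum_eq_sum (s := Finset.range n) fun k hk => if_neg (by simpa using hk),
      Finset.sum_congr rfl fun k hk => if_pos (Finset.mem_range.1 hk)]
    simp
  simp only [Finset.sum_filter]
  rw [Summable.tsum_finsetSum fun _ _ => ENNReal.summable]
  refine Finset.sum_congr rfl fun a _ => ?_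
  rw [hcount, ← ENNReal.tsum_mul_left]
  simp

open Classical in
/-- The length of the longest queue among the types that `b` can be matched with, `0` if there are
none. It is used for the queues of customers and for the queues of servers, with the two
orientations of the matching relation. -/
def longestQueue (R : A → B → Prop) (x : A → ℕ) (b : B) : ℕ :=
  ({a | R a b} : Finset A).sup x

theorem lt_longestQueue_iff {x : A → ℕ} {b : B} {k : ℕ} :
    k < longestQueue R x b ↔ ∃ a, R a b ∧ k < x a := by
  simp [longestQueue, Finset.lt_sup_iff]

theorem longestQueue_le {x : A → ℕ} {b : B} {n : ℕ} (h : ∀ a, R a b → x a ≤ n) :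
    longestQueue R x b ≤ n := by
  simpa [longestQueue] using h

variable [Fintype B]

open Classical in
theorem sum_mul_le_sum_mul_longestQueue {p : A → ℝ≥0∞} {q : B → ℝ≥0∞}
    (h : ∀ U ≠ Finset.univ, ∑ a ∈ U, p a ≤ ∑ b with ∃ a ∈ U, R a b, q b)
    {x : A → ℕ} (hx : ∃ a, x a = 0) :
    ∑ a, p a * x a ≤ ∑ b, q b * longestQueue R x b := by
  rw [sum_mul_natCast_eq_tsum, sum_mul_natCast_eq_tsum]
  refine ENNReal.tsum_le_tsum fun k => ?_
  obtain ⟨a, ha⟩ := hx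
  have hk : ({a | k < x a} : Finset A) ≠ Finset.univ := fun huniv => by
    simpa [ha] using Finset.eq_univ_iff_forall.1 huniv a
  simpa only [lt_longestQueue_iff, Finset.mem_filter_univ, and_comm] using h _ hk

open Classical in
theorem expect_add_mul_le_expect_longestQueue {p : PMF A} {q : PMF B} {δ : ℝ≥0}
    (h : ∀ U ≠ Finset.univ, ∑ a ∈ U, (p a + δ) ≤ ∑ b with ∃ a ∈ U, R a b, q b)
    {x : A → ℕ} (hx : ∃ a, x a = 0) :
    expect p (fun a => x a) + δ * ↑(∑ a, x a) ≤ expect q fun b => longestQueue R x b := by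
  simpa only [expect_eq_sum, add_mul, Finset.sum_add_distrib, ← Finset.mul_sum, Nat.cast_sum]
    using sum_mul_le_sum_mul_longestQueue h hx

theorem exists_eq_zero_of_mul_eq_zero [Nonempty A] (hR : ∀ b, ∃ a, R a b) {x : A → ℕ}
    {y : B → ℕ} (hsum : ∑ a, x a = ∑ b, y b) (hxy : ∀ a b, R a b → x a * y b = 0) :
    ∃ a, x a = 0 := by
  by_contra! hx
  have hy (b : B) : y b = 0 := by
    obtain ⟨a, hab⟩ := hR b
    exact (mul_eq_zero.1 (hxy a b hab)).resolve_left (hx a)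
  simp only [hy, Finset.sum_const_zero, Finset.sum_eq_zero_iff, Finset.mem_univ,
    true_implies] at hsum
  exact hx (Classical.arbitrary A) (hsum _)

end LongestQueue

section Lyapunov

variable {C S : Type*} [Fintype C] [Fintype S] {E : Set (C × S)}

theorem le_of_matchTheLongest_Φ_ne_zero {x : C → ℕ} {s : S}
    {h : Nonempty (AvailableCustomers E x s)} {i : AvailableCustomers E x s}
    (hi : (matchTheLongest E).Φ x s h i ≠ 0) {c : C} (hc : (c, s) ∈ E) : x c ≤ x i := by
  rw [← PMF.mem_support_iff] at hi
  simp only [matchTheLongest, PMF.mem_support_uniformOfFinset_iff, longestCustomers,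
    Finset.mem_filter_univ] at hi
  exact hi c hc

theorem le_of_matchTheLongest_Ψ_ne_zero {y : S → ℕ} {c : C}
    {h : Nonempty (AvailableServers E y c)} {j : AvailableServers E y c}
    (hj : (matchTheLongest E).Ψ y c h j ≠ 0) {s : S} (hs : (c, s) ∈ E) : y s ≤ y j := by
  rw [← PMF.mem_support_iff] at hj
  simp only [matchTheLongest, PMF.mem_support_uniformOfFinset_iff, longestServers,
    Finset.mem_filter_univ] at hj
  exact hj s hs

/-- The length of the longest queue of customers that can be matched with an `s`-server. -/
abbrev State.longestCustomerQueue (z : State E) (s : S) : ℕ :=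
  longestQueue (fun c s => (c, s) ∈ E) z.1.1 s

/-- The length of the longest queue of servers that can be matched with a `c`-customer. -/
abbrev State.longestServerQueue (z : State E) (c : C) : ℕ :=
  longestQueue (fun s c => (c, s) ∈ E) z.1.2 c

theorem State.longestCustomerQueue_le_zero {z : State E} {s : S}
    (h : ¬ Nonempty (AvailableCustomers E z.1.1 s)) : z.longestCustomerQueue s ≤ 0 :=
  longestQueue_le fun c hc => not_lt.1 fun hx => h ⟨c, hc, hx⟩

theorem State.longestServerQueue_le_zero {z : State E} {c : C}
    (h : ¬ Nonempty (AvailableServers E z.1.2 c)) : z.longestServerQueue c ≤ 0 :=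
  longestQueue_le fun s hs => not_lt.1 fun hy => h ⟨s, hs, hy⟩

/-- The sum of the squares of the queue lengths, the Lyapunov function of the policy ML. -/
def energy (z : State E) : ℕ := ∑ c, z.1.1 c ^ 2 + ∑ s, z.1.2 s ^ 2

theorem energy_step_le {z w : State E} {a : C × S} (hw : (matchTheLongest E).step z a w ≠ 0) :
    energy w + 2 * (z.longestCustomerQueue a.2 + z.longestServerQueue a.1) ≤
      energy z + 2 * (z.1.1 a.1 + z.1.2 a.2) + 2 := by
  rcases (matchTheLongest E).step_cases hw with ⟨hs, hc, i, j, hi, hj, rfl⟩ |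
    ⟨hs, hc, i, hi, rfl⟩ | ⟨hc, hs, j, hj, rfl⟩ | ⟨hs, hc, -, rfl⟩ | ⟨hE, hs, hc, rfl⟩
  · have hx := sum_sq_removeOne z.1.1 i i.2.2
    have hy := sum_sq_removeOne z.1.2 j j.2.2
    have hm : z.longestCustomerQueue a.2 ≤ z.1.1 i :=
      longestQueue_le fun _ => le_of_matchTheLongest_Φ_ne_zero hi
    have hn : z.longestServerQueue a.1 ≤ z.1.2 j :=
      longestQueue_le fun _ => le_of_matchTheLongest_Ψ_ne_zero hj
    simp only [energy, State.removeBoth]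
    omega
  · have hx := sum_sq_addOne_removeOne_le z.1.1 i a.1 i.2.2
    have hm : z.longestCustomerQueue a.2 ≤ z.1.1 i :=
      longestQueue_le fun _ => le_of_matchTheLongest_Φ_ne_zero hi
    have hn := z.longestServerQueue_le_zero hc
    simp only [energy, State.replaceCustomer]
    omega
  · have hy := sum_sq_addOne_removeOne_le z.1.2 j a.2 j.2.2
    have hm := z.longestCustomerQueue_le_zero hs
    have hn : z.longestServerQueue a.1 ≤ z.1.2 j :=
      longestQueue_le fun _ => le_of_matchTheLongest_Ψ_ne_zero hj
    simp only [energy, State.replaceServer]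
    omega
  · have hm := State.longestCustomerQueue_le_zero hs
    have hn := State.longestServerQueue_le_zero hc
    omega
  · have hx := sum_sq_addOne z.1.1 a.1
    have hy := sum_sq_addOne z.1.2 a.2
    have hm := z.longestCustomerQueue_le_zero hs
    have hn := z.longestServerQueue_le_zero hc
    simp only [energy, State.add]
    omega

theorem expect_energy_add_le (μ : PMF (C × S)) (z : State E) :
    expect ((matchTheLongest E).chain μ z) (fun w => energy w) +
        2 * (expect (μ.map Prod.snd) (fun s => z.longestCustomerQueue s) +
          expect (μ.map Prod.fst) fun c => z.longestServerQueue c) ≤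
      energy z + 2 * (expect (μ.map Prod.fst) (fun c => z.1.1 c) +
        expect (μ.map Prod.snd) fun s => z.1.2 s) + 2 := by
  have hstep : ∀ a, expect ((matchTheLongest E).step z a) (fun w => energy w) +
      2 * (z.longestCustomerQueue a.2 + z.longestServerQueue a.1) ≤
      energy z + 2 * (z.1.1 a.1 + z.1.2 a.2) + 2 := fun a => by
    rw [← expect_const ((matchTheLongest E).step z a) (2 * _), ← expect_add,
      ← expect_const ((matchTheLongest E).step z a) (_ + 2)]
    exact expect_mono fun w hw => mod_cast energy_step_le hw
  have hmean := expect_mono fun a (_ : μ a ≠ 0) => hstep a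
  simpa only [Policy.chain, expect_bind, expect_map, expect_add, expect_const_mul, expect_const]
    using hmean

theorem exists_expect_energy_le [Nonempty C] [Nonempty S] (hC : ∀ c, ∃ s, (c, s) ∈ E)
    (hS : ∀ s, ∃ c, (c, s) ∈ E) {μ : PMF (C × S)}
    (h : NCond E (μ.map Prod.fst) (μ.map Prod.snd)) :
    ∃ ε : ℝ≥0, 0 < ε ∧ ∀ z : State E,
      expect ((matchTheLongest E).chain μ z) (fun w => energy w) + ε * ↑(∑ c, z.1.1 c) ≤
        energy z + 2 := by
  classical
  obtain ⟨δ, ⟨hδC, hδS⟩, hδ⟩ := (((eventually_sum_add_le h.1).and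
    (eventually_sum_add_le h.2)).filter_mono (nhdsWithin_le_nhds (s := Set.Ioi 0))
    |>.and self_mem_nhdsWithin).exists
  refine ⟨4 * δ, mul_pos four_pos hδ, fun z => ?_⟩
  set X := expect (μ.map Prod.fst) fun c => (z.1.1 c : ℝ≥0∞)
  set Y := expect (μ.map Prod.snd) fun s => (z.1.2 s : ℝ≥0∞)
  have hX : X + δ * ↑(∑ c, z.1.1 c) ≤ expect (μ.map Prod.snd) fun s => z.longestCustomerQueue s :=
    expect_add_mul_le_expect_longestQueue hδC (exists_eq_zero_of_mul_eq_zero hS z.2.1 z.2.2)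
  have hY : Y + δ * ↑(∑ c, z.1.1 c) ≤ expect (μ.map Prod.fst) fun c => z.longestServerQueue c := by
    rw [z.2.1]
    exact expect_add_mul_le_expect_longestQueue hδS (exists_eq_zero_of_mul_eq_zero hC z.2.1.symm
      fun s c hcs => by rw [mul_comm, z.2.2 c s hcs])
  have hXY : 2 * (X + Y) ≠ ∞ := ENNReal.mul_ne_top ENNReal.ofNat_ne_top <| ENNReal.add_ne_top.2
    ⟨expect_ne_top _ fun _ => ENNReal.natCast_ne_top _,
      expect_ne_top _ fun _ => ENNReal.natCast_ne_top _⟩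
  refine (ENNReal.add_le_add_iff_right hXY).1 ?_
  set EL := expect ((matchTheLongest E).chain μ z) fun w => (energy w : ℝ≥0∞)
  calc EL + ↑(4 * δ) * ↑(∑ c, z.1.1 c) + 2 * (X + Y)
      = EL + 2 * ((X + δ * ↑(∑ c, z.1.1 c)) + (Y + δ * ↑(∑ c, z.1.1 c))) := by
        push_cast
        ring
    _ ≤ EL + 2 * (expect (μ.map Prod.snd) (fun s => z.longestCustomerQueue s) +
          expect (μ.map Prod.fst) fun c => z.longestServerQueue c) := by gcongr
    _ ≤ energy z + 2 * (X + Y) + 2 := expect_energy_add_le μ z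
    _ = energy z + 2 + 2 * (X + Y) := by ring

theorem finite_setOf_sum_le (n : ℕ) : {z : State E | ∑ c, z.1.1 c ≤ n}.Finite := by
  classical
  refine Set.Finite.of_injOn (f := Subtype.val)
    (t := Set.Icc (0 : (C → ℕ) × (S → ℕ)) (fun _ => n, fun _ => n)) (fun z hz => ?_)
    Subtype.val_injective.injOn (Set.finite_Icc _ _)
  refine ⟨zero_le, fun c => ?_, fun s => ?_⟩
  · exact (Finset.single_le_sum (fun _ _ => Nat.zero_le _) (Finset.mem_univ c)).trans hz
  · exact (Finset.single_le_sum (fun _ _ => Nat.zero_le _) (Finset.mem_univ s)).trans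
      (z.2.1.symm.trans_le hz)

theorem finite_setOf_mul_sum_lt {ε : ℝ≥0} (hε : 0 < ε) (n : ℕ) :
    {z : State E | (ε * ↑(∑ c, z.1.1 c) : ℝ≥0∞) < n}.Finite := by
  refine (finite_setOf_sum_le ⌈n / ε⌉₊).subset fun z hz => ?_
  have hlt : (ε * ↑(∑ c, z.1.1 c) : ℝ≥0∞) < n := hz
  exact Nat.cast_le.1 (((lt_div_iff₀' hε).2 (mod_cast hlt)).le.trans (Nat.le_ceil (n / ε)))

end Lyapunov

/-! ### The stability region -/

section StabilityRegion

variable {C S : Type*} {E : Set (C × S)}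

theorem nonempty_of_connected [Nonempty C] [Nonempty S] (hE : (matchingGraph E).Connected) :
    E.Nonempty := by
  obtain ⟨⟨c⟩, ⟨s⟩⟩ := And.intro ‹Nonempty C› ‹Nonempty S›
  have : Nontrivial (C ⊕ S) := ⟨Sum.inl c, Sum.inr s, Sum.inl_ne_inr⟩
  obtain ⟨a, ha⟩ := hE.preconnected.exists_adj_of_nontrivial (Sum.inl c)
  obtain ⟨-, ⟨c, s, hcs, -⟩ | ⟨c, s, hcs, -⟩⟩ := (SimpleGraph.fromRel_adj _ _ _).1 ha
  all_goals exact ⟨_, hcs⟩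

variable [Fintype C] [Fintype S]

theorem isStable_matchTheLongest_of_ncond (hE : E.Nonempty) {μ : PMF (C × S)}
    (h : NCond E (μ.map Prod.fst) (μ.map Prod.snd)) :
    IsStable ((matchTheLongest E).chain μ) := by
  obtain ⟨hC, hS⟩ := exists_mem_of_ncond h hE
  have : Nonempty C := hE.to_subtype.map fun a => a.1.1
  have : Nonempty S := hE.to_subtype.map fun a => a.1.2
  obtain ⟨ε, hε, hdrift⟩ := exists_expect_energy_le hC hS h
  refine isStable_of_isTight ((matchTheLongest E).reachable_emptyState h hS) fun z =>
    isTight_cesaro_of_drift hdrift ENNReal.ofNat_ne_top (finite_setOf_mul_sum_lt hε) ?_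
  rw [expect_pure]
  exact ENNReal.natCast_ne_top _

end StabilityRegion

theorem mainTheorem1_general {C S : Type*} [Fintype C] [Fintype S] {E : Set (C × S)}
    (hE : E.Nonempty) : (matchTheLongest E).HasMaximalStabilityRegion :=
  Set.ext fun _ => and_congr_right fun hμ =>
    ⟨(matchTheLongest E).ncond_of_isStable hμ, isStable_matchTheLongest_of_ncond hE⟩

end BipartiteMatching

end

open BipartiteMatching in
theorem mainTheorem1 {C S : Type*} [Fintype C] [Fintype S] [Nonempty C] [Nonempty S]
    (E : Set (C × S)) (hE : (BipartiteMatching.matchingGraph E).Connected) :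
    (BipartiteMatching.matchTheLongest E).HasMaximalStabilityRegion :=
  mainTheorem1_general (nonempty_of_connected hE)
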